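/- Let $G$ and $H$ be locally compact groups and let $A$ be a (complex, not necessarily unital) C*-algebra. Let $\lambda$ and $\sigma$ be strongly continuous actions by $*$-automorphisms of $G$ and $H$, respectively, on $A$, and suppose that they commute: $\lambda_x\sigma_h=\sigma_h\lambda_x$ for all $x\in G$, $h\in H$. Denote by $\mathcal{UZM}(A)$ the set of unitary elements of the center of the multiplier algebra $\mathcal M(A)$, and extend each $\lambda_x$ and $\sigma_h$ canonically to $\mathcal M(A)$. Let $u:G\times H\to\mathcal{UZM}(A)$ be continuous for the strict topology of $\mathcal M(A)$ and satisfy $$u(xy,h)=u(x,h)\,\lambda_x(u(y,h)),\qquad u(x,hg)=u(x,h)\,\sigma_h(u(x,g))$$ for all $x,y\in G$ and $h,g\in H$. Let $A\rtimes_\lambda G$ be the (full) crossed product, i.e. the completion of the $*$-algebra $C_c(G,A)$, with convolution and involution taken with respect to a fixed left Haar measure on $G$, in the universal norm $\|\Phi\|=\sup\|(\Pi\times V)(\Phi)\|$, the supremum being over all nondegenerate covariant representations $(\Pi,V)$ of $(A,G,\lambda)$, where $(\Pi\times V)(\Phi)\xi=\int_G\Pi(\Phi(x))V_x\xi\,dx$.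 For $h\in H$ and $\Phi\in C_c(G,A)$ put $$(\gamma_h\Phi)(x)=u(x,h)\,\sigma_h(\Phi(x)),\qquad x\in G.$$ Then $\gamma_h\Phi\in C_c(G,A)$, each $\gamma_h$ extends (uniquely) to a $*$-automorphism of $A\rtimes_\lambda G$, and $h\mapsto\gamma_h$ is a strongly continuous action of $H$ on $A\rtimes_\lambda G$: that is, $\gamma_{hg}=\gamma_h\gamma_g$ for all $h,g\in H$, and $h\mapsto\gamma_h(b)$ is norm continuous for every $b\in A\rtimes_\lambda G$. -/

import Mathlib

open MeasureTheory MeasureTheory.Measure Filter Topology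
open scoped ENNReal NNReal MultiplierAlgebra CompactlySupported

universe u v w

noncomputable section

/-! ### Actions on C*-algebras and the multiplier algebra -/

section Actions

variable {G : Type u} {A : Type w} [Group G] [TopologicalSpace G] [NonUnitalCStarAlgebra A]

/-- A strongly continuous action of a topological group `G` on a C*-algebra `A`: a homomorphism
from `G` to the group of *-automorphisms of `A`, such that `g ↦ α g a` is norm continuous for every
`a` in `A`. -/
structure CStarAction (G : Type u) (A : Type w) [Group G] [TopologicalSpace G]
    [NonUnitalCStarAlgebra A] where
  /-- The underlying homomorphism into the automorphism group. -/
  toHom : G →* (A ≃⋆ₐ[ℂ] A)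
  continuous_orbit : ∀ a : A, Continuous fun g => toHom g a

instance : CoeFun (CStarAction G A) (fun _ => G → (A ≃⋆ₐ[ℂ] A)) := ⟨fun α => ⇑α.toHom⟩

/-- A *-automorphism of a C*-algebra, as a continuous linear map. -/
def StarAlgEquiv.asCLM (φ : A ≃⋆ₐ[ℂ] A) : A →L[ℂ] A where
  toFun := φ
  map_add' := map_add φ
  map_smul' := map_smul φ
  cont := (StarAlgEquiv.isometry φ).continuous

/-- The canonical extension of a *-automorphism `φ` of `A` to the multiplier algebra: the
multiplier `φ(m)` acts by `φ(m) a = φ(m (φ⁻¹ a))` and `a φ(m) = φ((φ⁻¹ a) m)`. (For a multiplier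
`m`, `m.fst a` is the product `m a` and `m.snd a` is the product `a m`.) -/
def multiplierExtend (φ : A ≃⋆ₐ[ℂ] A) (m : 𝓜(ℂ, A)) : 𝓜(ℂ, A) where
  fst := φ.asCLM ∘L m.fst ∘L φ.symm.asCLM
  snd := φ.asCLM ∘L m.snd ∘L φ.symm.asCLM
  central x y := by
    change φ (m.snd (φ.symm x)) * y = x * φ (m.fst (φ.symm y))
    have h := congrArg φ (m.central (φ.symm x) (φ.symm y))
    simpa using h

/-- Continuity for the strict topology of the multiplier algebra: that is the topology generated
by the seminorms `m ↦ ‖m a‖` and `m ↦ ‖a m‖`, for `a` in `A`. -/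
def StrictlyContinuous {X : Type*} [TopologicalSpace X] (f : X → 𝓜(ℂ, A)) : Prop :=
  (∀ a : A, Continuous fun x => (f x).fst a) ∧ ∀ a : A, Continuous fun x => (f x).snd a

/-- Joint continuity of a strongly continuous action. -/
theorem CStarAction.continuous_apply (α : CStarAction G A) {X : Type*} [TopologicalSpace X]
    {s : X → G} {f : X → A} (hs : Continuous s) (hf : Continuous f) :
    Continuous fun x => α (s x) (f x) := by
  rw [continuous_iff_continuousAt]
  intro x₀
  have h1 : Tendsto (fun x => α (s x) (f x₀)) (𝓝 x₀) (𝓝 (α (s x₀) (f x₀))) :=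
    ((α.continuous_orbit (f x₀)).comp hs).continuousAt
  have h2 : Tendsto (fun x => α (s x) (f x - f x₀)) (𝓝 x₀) (𝓝 0) := by
    rw [tendsto_zero_iff_norm_tendsto_zero]
    have h3 : Tendsto (fun x => ‖f x - f x₀‖) (𝓝 x₀) (𝓝 0) := by
      have := (hf.sub (continuous_const (y := f x₀))).norm.tendsto x₀
      simpa using this
    refine h3.congr fun x => ?_
    exact (StarAlgEquiv.norm_map (α (s x)) _).symm
  have := h1.add h2
  rw [add_zero] at this
  refine this.congr fun x => ?_
  rw [← map_add]
  congr 1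
  abel

end Actions

/-! ### Two facts about Haar integrals of compactly supported continuous functions -/

section Haar

variable {G : Type u} [Group G] [TopologicalSpace G] [IsTopologicalGroup G]
  [LocallyCompactSpace G] [MeasurableSpace G] [BorelSpace G]

/-- `∫ g(yx) dy = Δ(x)⁻¹ ∫ g(y) dy`, where `modularCharacter x` is the inverse of the value `Δ(x)`
of the modular function in the usual normalization `μ(Ex) = Δ(x) μ(E)`. -/
theorem integral_mul_right_modularCharacter (μ : Measure G) [μ.IsHaarMeasure] {g : G → ℝ}
    (hg : Continuous g) (h'g : HasCompactSupport g) (x : G) :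
    ∫ y, g (y * x) ∂μ = (modularCharacter x : ℝ) * ∫ y, g y ∂μ := by
  have h := integral_isMulLeftInvariant_eq_smul_of_hasCompactSupport (map (· * x) μ) μ hg h'g
  rw [integral_map (AEMeasurable.mul_const aemeasurable_id' _)
    (Continuous.aestronglyMeasurable hg)] at h
  rw [h, integral_smul_nnreal_measure, ← modularCharacterFun_eq_haarScalarFactor]
  rfl

theorem continuous_modularCharacter_real : Continuous fun x : G => (modularCharacter x : ℝ) := by
  let μ : Measure G := haar
  obtain ⟨⟨g, hg⟩, h'g, g0, g1⟩ : ∃ f : C(G, ℝ), HasCompactSupport f ∧ 0 ≤ f ∧ f 1 ≠ 0 :=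
    exists_continuous_nonneg_pos 1
  have hc : ∫ y, g y ∂μ ≠ 0 :=
    ne_of_gt (hg.integral_pos_of_hasCompactSupport_nonneg_nonzero h'g g0 g1)
  have h : ∀ x : G, (modularCharacter x : ℝ) = (∫ y, g (y⁻¹ * x) ∂μ.inv) / ∫ y, g y ∂μ := by
    intro x
    have h := (MeasurableEquiv.inv G).measurableEmbedding.integral_map (μ := μ)
      (fun y => g (y⁻¹ * x))
    simp only [MeasurableEquiv.inv_apply, inv_inv] at h
    rw [eq_div_iff hc, ← integral_mul_right_modularCharacter μ hg h'g x, ← h]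
    rfl
  simp_rw [h]
  exact (continuous_integral_apply_inv_mul hg h'g).div_const _

theorem integral_inv_modularCharacter (μ : Measure G) [μ.IsHaarMeasure] {E : Type*}
    [NormedAddCommGroup E] [NormedSpace ℝ E] [CompleteSpace E] {f : G → E}
    (hf : Continuous f) (h'f : HasCompactSupport f) :
    ∫ x, (modularCharacter x : ℝ) • f x⁻¹ ∂μ = ∫ x, f x ∂μ := by
  obtain ⟨⟨g, hg⟩, h'g, g0, g1⟩ : ∃ f : C(G, ℝ), HasCompactSupport f ∧ 0 ≤ f ∧ f 1 ≠ 0 :=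
    exists_continuous_nonneg_pos 1
  simp only [ContinuousMap.coe_mk] at h'g
  have hc : ∫ y, g y ∂μ ≠ 0 :=
    ne_of_gt (hg.integral_pos_of_hasCompactSupport_nonneg_nonzero h'g g0 g1)
  refine smul_right_injective E hc ?_
  change (∫ y, g y ∂μ) • (∫ x, (modularCharacter x : ℝ) • f x⁻¹ ∂μ)
    = (∫ y, g y ∂μ) • ∫ x, f x ∂μ
  calc (∫ y, g y ∂μ) • (∫ x, (modularCharacter x : ℝ) • f x⁻¹ ∂μ)
      = ∫ x, (∫ y, g (y * x) • f x⁻¹ ∂μ) ∂μ := by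
        rw [← integral_smul]
        congr with x
        rw [integral_smul_const, integral_mul_right_modularCharacter μ hg h'g, smul_smul, mul_comm]
    _ = ∫ y, (∫ x, g (y * x) • f x⁻¹ ∂μ) ∂μ := by
        apply integral_integral_swap_of_hasCompactSupport
        · fun_prop
        · let F : G × G ≃ₜ G × G :=
            { toFun := fun p => (p.2 * p.1, p.1⁻¹)
              invFun := fun p => (p.2⁻¹, p.1 * p.2)
              left_inv := fun p => by simp
              right_inv := fun p => by simp
              continuous_toFun := by fun_prop
              continuous_invFun := by fun_prop }
          have : HasCompactSupport fun p : G × G => g p.1 • f p.2 := by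
            refine HasCompactSupport.intro' (h'g.prod h'f)
              ((isClosed_tsupport g).prod (isClosed_tsupport f)) ?_
            rintro ⟨a, b⟩ hab
            by_cases ha : a ∈ tsupport g
            · have hb : b ∉ tsupport f := fun hb => hab ⟨ha, hb⟩
              simp [image_eq_zero_of_notMem_tsupport hb]
            · simp [image_eq_zero_of_notMem_tsupport ha]
          exact this.comp_homeomorph F
    _ = ∫ y, (∫ x, g x • f (x⁻¹ * y) ∂μ) ∂μ := by
        congr with y
        rw [← integral_mul_left_eq_self _ y⁻¹]
        simp
    _ = ∫ x, (∫ y, g x • f (x⁻¹ * y) ∂μ) ∂μ := by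
        apply integral_integral_swap_of_hasCompactSupport
        · fun_prop
        · let F : G × G ≃ₜ G × G :=
            { toFun := fun p => (p.2, p.2⁻¹ * p.1)
              invFun := fun p => (p.1 * p.2, p.1)
              left_inv := fun p => by simp
              right_inv := fun p => by simp
              continuous_toFun := by fun_prop
              continuous_invFun := by fun_prop }
          have : HasCompactSupport fun p : G × G => g p.1 • f p.2 := by
            refine HasCompactSupport.intro' (h'g.prod h'f)
              ((isClosed_tsupport g).prod (isClosed_tsupport f)) ?_
            rintro ⟨a, b⟩ hab
            by_cases ha : a ∈ tsupport g
            · have hb : b ∉ tsupport f := fun hb => hab ⟨ha, hb⟩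
              simp [image_eq_zero_of_notMem_tsupport hb]
            · simp [image_eq_zero_of_notMem_tsupport ha]
          exact this.comp_homeomorph F
    _ = (∫ y, g y ∂μ) • ∫ x, f x ∂μ := by
        rw [← integral_smul_const]
        congr with x
        rw [integral_smul, integral_mul_left_eq_self]

end Haar

/-! ### Crossed products -/

section CrossedProduct

variable {G : Type u} {A : Type w} [Group G] [TopologicalSpace G] [NonUnitalCStarAlgebra A]

/-- A (nondegenerate) covariant representation of the C*-dynamical system `(A, G, α)` on a complex
Hilbert space `space`. The Hilbert spaces range over the universe of `C_c(G, A)`; every cyclic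
representation, hence the universal norm, already occurs there. -/
structure CovariantRep (α : CStarAction G A) where
  space : Type (max u w)
  [normed : NormedAddCommGroup space]
  [innerProduct : InnerProductSpace ℂ space]
  [complete : CompleteSpace space]
  /-- The representation of the algebra. -/
  rep : A →⋆ₙₐ[ℂ] (space →L[ℂ] space)
  /-- The unitary representation of the group. -/
  unit : G →* unitary (space →L[ℂ] space)
  nondegenerate : (Submodule.span ℂ {η : space | ∃ a ξ, rep a ξ = η}).topologicalClosure = ⊤
  continuous_unit : ∀ ξ : space, Continuous fun x => (unit x : space →L[ℂ] space) ξ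
  covariant : ∀ x a, (unit x : space →L[ℂ] space) * rep a * star (unit x : space →L[ℂ] space)
    = rep (α x a)

attribute [instance] CovariantRep.normed CovariantRep.innerProduct CovariantRep.complete

namespace CovariantRep

variable {α : CStarAction G A} (π : CovariantRep α)

theorem continuous_rep : Continuous π.rep :=
  AddMonoidHomClass.continuous_of_bound π.rep 1 fun a => by
    simpa only [one_mul] using NonUnitalStarAlgHom.norm_apply_le π.rep a

theorem norm_rep_le (a : A) : ‖π.rep a‖ ≤ ‖a‖ := NonUnitalStarAlgHom.norm_apply_le π.rep a

theorem norm_unit (x : G) (ξ : π.space) : ‖(π.unit x : π.space →L[ℂ] π.space) ξ‖ = ‖ξ‖ := by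
  have h := (π.unit x).2.1
  have := congrArg (fun T : π.space →L[ℂ] π.space => inner ℂ (T ξ) ξ) h
  simp only [ContinuousLinearMap.star_eq_adjoint, _root_.mul_apply_eq_comp,
    ContinuousLinearMap.adjoint_inner_left, _root_.one_apply_eq_self] at this
  rw [inner_self_eq_norm_sq_to_K, inner_self_eq_norm_sq_to_K] at this
  exact (sq_eq_sq₀ (norm_nonneg _) (norm_nonneg _)).1 (by exact_mod_cast this)

theorem unit_mul_apply (x y : G) (ξ : π.space) :
    (π.unit (x * y) : π.space →L[ℂ] π.space) ξ
      = (π.unit x : π.space →L[ℂ] π.space) ((π.unit y : π.space →L[ℂ] π.space) ξ) := by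
  simp

theorem inner_unit_left (x : G) (ξ η : π.space) :
    inner ℂ ((π.unit x : π.space →L[ℂ] π.space) ξ) η
      = inner ℂ ξ ((π.unit x⁻¹ : π.space →L[ℂ] π.space) η) := by
  have : (π.unit x⁻¹ : π.space →L[ℂ] π.space) = star (π.unit x : π.space →L[ℂ] π.space) := by
    rw [map_inv]; rfl
  rw [this, ContinuousLinearMap.star_eq_adjoint, ContinuousLinearMap.adjoint_inner_right]

theorem inner_rep_left (a : A) (ξ η : π.space) :
    inner ℂ (π.rep (star a) ξ) η = inner ℂ ξ (π.rep a η) := by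
  rw [map_star, ContinuousLinearMap.star_eq_adjoint, ContinuousLinearMap.adjoint_inner_left]

/-- Covariance, in the form `V_x Π(a) ξ = Π(α_x(a)) V_x ξ`. -/
theorem unit_rep_apply (x : G) (a : A) (ξ : π.space) :
    (π.unit x : π.space →L[ℂ] π.space) (π.rep a ξ)
      = π.rep (α x a) ((π.unit x : π.space →L[ℂ] π.space) ξ) := by
  rw [← π.covariant x a]
  have h : star (π.unit x : π.space →L[ℂ] π.space) * (π.unit x : π.space →L[ℂ] π.space) = 1 :=
    (π.unit x).2.1
  have h' := congrArg (fun T : π.space →L[ℂ] π.space => T ξ) h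
  simp only [_root_.mul_apply_eq_comp, _root_.one_apply_eq_self] at h'
  simp only [_root_.mul_apply_eq_comp, h']

theorem continuous_rep_unit {X : Type*} [TopologicalSpace X] {f : X → A} {s : X → G}
    (hf : Continuous f) (hs : Continuous s) (ξ : π.space) :
    Continuous fun x => π.rep (f x) ((π.unit (s x) : π.space →L[ℂ] π.space) ξ) :=
  (π.continuous_rep.comp hf).clm_apply ((π.continuous_unit ξ).comp hs)

theorem hasCompactSupport_rep_unit (Φ : C_c(G, A)) (ξ : π.space) :
    HasCompactSupport fun x => π.rep (Φ x) ((π.unit x : π.space →L[ℂ] π.space) ξ) :=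
  Φ.hasCompactSupport.mono fun x hx h => hx (by simp [h])

variable [MeasurableSpace G] [BorelSpace G] (μ : Measure G) [IsFiniteMeasureOnCompacts μ]

theorem integrable_rep_unit (Φ : C_c(G, A)) (ξ : π.space) :
    Integrable (fun x => π.rep (Φ x) ((π.unit x : π.space →L[ℂ] π.space) ξ)) μ :=
  (π.continuous_rep_unit Φ.continuous continuous_id ξ).integrable_of_hasCompactSupport
    (π.hasCompactSupport_rep_unit Φ ξ)

theorem norm_integral_rep_unit_le (Φ : C_c(G, A)) (ξ : π.space) :
    ‖∫ x, π.rep (Φ x) ((π.unit x : π.space →L[ℂ] π.space) ξ) ∂μ‖ ≤ (∫ x, ‖Φ x‖ ∂μ) * ‖ξ‖ := by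
  rw [← integral_mul_const]
  refine norm_integral_le_of_norm_le ?_ (ae_of_all _ fun x => ?_)
  · exact ((Φ.continuous.norm.integrable_of_hasCompactSupport
      Φ.hasCompactSupport.norm).mul_const _)
  · refine (ContinuousLinearMap.le_opNorm _ _).trans ?_
    rw [π.norm_unit]
    exact mul_le_mul_of_nonneg_right (π.norm_rep_le _) (norm_nonneg _)

/-- The integrated form `(Π × V)(Φ) ξ = ∫ Π(Φ(x)) V_x ξ dx` of a covariant representation. -/
def integratedForm (Φ : C_c(G, A)) : π.space →L[ℂ] π.space :=
  LinearMap.mkContinuous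
    { toFun := fun ξ => ∫ x, π.rep (Φ x) ((π.unit x : π.space →L[ℂ] π.space) ξ) ∂μ
      map_add' := fun ξ η => by
        simp only [map_add]
        exact integral_add (π.integrable_rep_unit μ Φ ξ) (π.integrable_rep_unit μ Φ η)
      map_smul' := fun c ξ => by
        simp only [map_smul, RingHom.id_apply]
        exact integral_smul _ _ }
    (∫ x, ‖Φ x‖ ∂μ) (π.norm_integral_rep_unit_le μ Φ)

theorem integratedForm_apply (Φ : C_c(G, A)) (ξ : π.space) :
    π.integratedForm μ Φ ξ = ∫ x, π.rep (Φ x) ((π.unit x : π.space →L[ℂ] π.space) ξ) ∂μ := rfl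

theorem norm_integratedForm_le (Φ : C_c(G, A)) : ‖π.integratedForm μ Φ‖ ≤ ∫ x, ‖Φ x‖ ∂μ :=
  LinearMap.mkContinuous_norm_le _ (integral_nonneg fun _ => norm_nonneg _) _

end CovariantRep

variable [IsTopologicalGroup G] (α : CStarAction G A)

theorem continuous_convolution_integrand (Φ Ψ : C_c(G, A)) :
    Continuous fun p : G × G => Φ p.2 * α p.2 (Ψ (p.2⁻¹ * p.1)) :=
  (Φ.continuous.comp continuous_snd).mul
    (α.continuous_apply continuous_snd (Ψ.continuous.comp (by fun_prop)))

theorem hasCompactSupport_convolution_integrand (Φ Ψ : C_c(G, A)) :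
    HasCompactSupport fun p : G × G => Φ p.2 * α p.2 (Ψ (p.2⁻¹ * p.1)) := by
  let F : G × G ≃ₜ G × G :=
    { toFun := fun p => (p.2, p.2⁻¹ * p.1)
      invFun := fun p => (p.1 * p.2, p.1)
      left_inv := fun p => by simp
      right_inv := fun p => by simp
      continuous_toFun := by fun_prop
      continuous_invFun := by fun_prop }
  have : HasCompactSupport fun p : G × G => Φ p.1 * α p.1 (Ψ p.2) := by
    refine HasCompactSupport.intro' (Φ.hasCompactSupport.prod Ψ.hasCompactSupport)
      ((isClosed_tsupport Φ).prod (isClosed_tsupport Ψ)) ?_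
    rintro ⟨a, b⟩ hab
    by_cases ha : a ∈ tsupport Φ
    · have hb : b ∉ tsupport Ψ := fun hb => hab ⟨ha, hb⟩
      simp [image_eq_zero_of_notMem_tsupport hb]
    · simp [image_eq_zero_of_notMem_tsupport ha]
  exact this.comp_homeomorph F

variable [LocallyCompactSpace G] [MeasurableSpace G] [BorelSpace G] (μ : Measure G)
  [μ.IsHaarMeasure]

/-- The product `(Φ * Ψ)(x) = ∫ Φ(y) α_y(Ψ(y⁻¹ x)) dy` of `C_c(G, A)`. -/
def convolutionCc (Φ Ψ : C_c(G, A)) : C_c(G, A) where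
  toFun x := ∫ y, Φ y * α y (Ψ (y⁻¹ * x)) ∂μ
  continuous_toFun := by
    rw [← continuousOn_univ]
    refine continuousOn_integral_of_compact_support Φ.hasCompactSupport
      (continuous_convolution_integrand α Φ Ψ).continuousOn ?_
    intro x y _ hy
    simp [image_eq_zero_of_notMem_tsupport hy]
  hasCompactSupport' := by
    have hK := (hasCompactSupport_convolution_integrand α Φ Ψ).isCompact.image continuous_fst
    refine HasCompactSupport.intro' hK.closure isClosed_closure fun x hx => ?_
    refine integral_eq_zero_of_ae (ae_of_all _ fun y => ?_)
    by_contra h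
    exact hx (subset_closure ⟨(x, y), subset_tsupport _ h, rfl⟩)

/-- The involution `Φ^*(x) = Δ(x)⁻¹ α_x(Φ(x⁻¹)^*)` of `C_c(G, A)`. Mathlib's `modularCharacter` is
`x ↦ Δ(x)⁻¹` for the modular function `Δ` with `μ(Ex) = Δ(x) μ(E)`. -/
def involutionCc (Φ : C_c(G, A)) : C_c(G, A) where
  toFun x := (modularCharacter x : ℝ) • α x (star (Φ x⁻¹))
  continuous_toFun := continuous_modularCharacter_real.smul
    (α.continuous_apply continuous_id (Φ.continuous.comp continuous_inv).star)
  hasCompactSupport' := by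
    have h : HasCompactSupport fun x => Φ x⁻¹ :=
      Φ.hasCompactSupport.comp_homeomorph (Homeomorph.inv G)
    exact h.mono fun x hx h => hx (by simp [h])

variable {α} in
theorem CovariantRep.integratedForm_convolutionCc (π : CovariantRep α) (Φ Ψ : C_c(G, A)) :
    π.integratedForm μ (convolutionCc α μ Φ Ψ)
      = π.integratedForm μ Φ * π.integratedForm μ Ψ := by
  ext ξ
  have hc := continuous_convolution_integrand α Φ Ψ
  have hs := hasCompactSupport_convolution_integrand α Φ Ψ
  calc π.integratedForm μ (convolutionCc α μ Φ Ψ) ξ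
      = ∫ x, (∫ y, π.rep (Φ y * α y (Ψ (y⁻¹ * x)))
          ((π.unit x : π.space →L[ℂ] π.space) ξ) ∂μ) ∂μ := by
        rw [integratedForm_apply]
        congr with x
        let L : A →L[ℂ] π.space :=
          ⟨{ toFun := fun a => π.rep a ((π.unit x : π.space →L[ℂ] π.space) ξ)
             map_add' := fun a b => by simp
             map_smul' := fun c a => by simp },
            π.continuous_rep.clm_apply continuous_const⟩
        refine (L.integral_comp_comm (μ := μ)
          (φ := fun y => Φ y * α y (Ψ (y⁻¹ * x))) ?_).symm
        refine (hc.comp (Continuous.prodMk_right x)).integrable_of_hasCompactSupport ?_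
        refine Φ.hasCompactSupport.mono fun y hy h => hy ?_
        simp [h]
    _ = ∫ y, (∫ x, π.rep (Φ y * α y (Ψ (y⁻¹ * x)))
          ((π.unit x : π.space →L[ℂ] π.space) ξ) ∂μ) ∂μ := by
        apply integral_integral_swap_of_hasCompactSupport
        · exact π.continuous_rep_unit hc continuous_fst ξ
        · refine hs.mono fun p hp h => hp ?_
          simp only [Function.uncurry]
          simp only [] at h
          rw [h]
          simp
    _ = ∫ y, (∫ x, π.rep (Φ y) ((π.unit y : π.space →L[ℂ] π.space)
          (π.rep (Ψ x) ((π.unit x : π.space →L[ℂ] π.space) ξ))) ∂μ) ∂μ := by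
        congr with y
        rw [← integral_mul_left_eq_self _ y]
        congr with x
        rw [inv_mul_cancel_left, π.unit_mul_apply, map_mul, π.unit_rep_apply]
        rfl
    _ = (π.integratedForm μ Φ * π.integratedForm μ Ψ) ξ := by
        rw [_root_.mul_apply_eq_comp, integratedForm_apply]
        congr with y
        rw [integratedForm_apply]
        exact ((π.rep (Φ y)) ∘L (π.unit y : π.space →L[ℂ] π.space)).integral_comp_comm
          (π.integrable_rep_unit μ Ψ ξ)

variable {α} in
theorem CovariantRep.integratedForm_involutionCc (π : CovariantRep α) (Φ : C_c(G, A)) :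
    π.integratedForm μ (involutionCc α Φ) = star (π.integratedForm μ Φ) := by
  rw [ContinuousLinearMap.star_eq_adjoint, ContinuousLinearMap.eq_adjoint_iff]
  intro ξ η
  have h1 : inner ℂ (π.integratedForm μ (involutionCc α Φ) ξ) η
      = ∫ x, inner ℂ (π.rep (involutionCc α Φ x) ((π.unit x : π.space →L[ℂ] π.space) ξ)) η ∂μ := by
    rw [integratedForm_apply, ← inner_conj_symm,
      ← integral_inner (π.integrable_rep_unit μ (involutionCc α Φ) ξ), ← integral_conj]
    simp only [inner_conj_symm]
  have h2 : inner ℂ ξ (π.integratedForm μ Φ η)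
      = ∫ x, inner ℂ ξ (π.rep (Φ x) ((π.unit x : π.space →L[ℂ] π.space) η)) ∂μ := by
    rw [integratedForm_apply, ← integral_inner (π.integrable_rep_unit μ Φ η)]
  rw [h1, h2, ← integral_inv_modularCharacter μ
    (f := fun x => inner ℂ ξ (π.rep (Φ x) ((π.unit x : π.space →L[ℂ] π.space) η)))]
  · congr with x
    change inner ℂ (π.rep ((modularCharacter x : ℝ) • α x (star (Φ x⁻¹)))
      ((π.unit x : π.space →L[ℂ] π.space) ξ)) η = _
    rw [← Complex.coe_smul, map_smul, _root_.smul_apply, ← π.unit_rep_apply,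
      inner_smul_left, π.inner_unit_left, π.inner_rep_left, Complex.conj_ofReal,
      Complex.real_smul]
  · exact continuous_const.inner (π.continuous_rep_unit Φ.continuous continuous_id η)
  · exact (π.hasCompactSupport_rep_unit Φ η).mono fun x hx h => hx (by simp [h])

/-- The C*-algebra of bounded families of operators, one on the space of each covariant
representation, with the supremum norm. -/
def OperatorFamilies : Type (max u w + 1) :=
  lp (fun π : CovariantRep α => π.space →L[ℂ] π.space) ∞

instance : NonUnitalCStarAlgebra (OperatorFamilies α) :=
  inferInstanceAs (NonUnitalCStarAlgebra (lp (fun π : CovariantRep α => π.space →L[ℂ] π.space) ∞))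

/-- The direct sum of the integrated forms of all covariant representations. Its norm
`‖universalForm α μ Φ‖ = sup ‖(Π × V)(Φ)‖` is the universal norm on `C_c(G, A)`. -/
def universalForm : C_c(G, A) →ₗ[ℂ] OperatorFamilies α where
  toFun Φ := (⟨fun π => π.integratedForm μ Φ, memℓp_infty
    ⟨∫ x, ‖Φ x‖ ∂μ, by rintro _ ⟨π, rfl⟩; exact π.norm_integratedForm_le μ Φ⟩⟩ :
      lp (fun π : CovariantRep α => π.space →L[ℂ] π.space) ∞)
  map_add' Φ Ψ := by
    refine lp.ext (funext fun π => ContinuousLinearMap.ext fun ξ => ?_)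
    change π.integratedForm μ (Φ + Ψ) ξ = π.integratedForm μ Φ ξ + π.integratedForm μ Ψ ξ
    simp only [CovariantRep.integratedForm_apply, CompactlySupportedContinuousMap.add_apply,
      map_add, _root_.add_apply]
    exact integral_add (π.integrable_rep_unit μ Φ ξ) (π.integrable_rep_unit μ Ψ ξ)
  map_smul' c Φ := by
    refine lp.ext (funext fun π => ContinuousLinearMap.ext fun ξ => ?_)
    change π.integratedForm μ (c • Φ) ξ = c • π.integratedForm μ Φ ξ
    simp only [CovariantRep.integratedForm_apply, CompactlySupportedContinuousMap.smul_apply,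
      map_smul, _root_.smul_apply]
    exact integral_smul _ _

theorem universalForm_convolutionCc (Φ Ψ : C_c(G, A)) :
    universalForm α μ (convolutionCc α μ Φ Ψ) = universalForm α μ Φ * universalForm α μ Ψ := by
  exact lp.ext (funext fun π => π.integratedForm_convolutionCc μ Φ Ψ)

theorem universalForm_involutionCc (Φ : C_c(G, A)) :
    universalForm α μ (involutionCc α Φ) = star (universalForm α μ Φ) := by
  exact lp.ext (funext fun π => π.integratedForm_involutionCc μ Φ)

/-- The image of the convolution *-algebra `C_c(G, A)` under its universal representation. -/
def universalImage :
    NonUnitalStarSubalgebra ℂ (OperatorFamilies α) where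
  carrier := Set.range (universalForm α μ)
  add_mem' := by
    rintro _ _ ⟨Φ, rfl⟩ ⟨Ψ, rfl⟩
    exact ⟨Φ + Ψ, map_add _ _ _⟩
  zero_mem' := ⟨0, map_zero _⟩
  mul_mem' := by
    rintro _ _ ⟨Φ, rfl⟩ ⟨Ψ, rfl⟩
    exact ⟨convolutionCc α μ Φ Ψ, universalForm_convolutionCc α μ Φ Ψ⟩
  smul_mem' := by
    rintro c _ ⟨Φ, rfl⟩
    exact ⟨c • Φ, map_smul _ _ _⟩
  star_mem' := by
    rintro _ ⟨Φ, rfl⟩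
    exact ⟨involutionCc α Φ, universalForm_involutionCc α μ Φ⟩

/-- The (full) crossed product `A ⋊_α G`: the completion of the convolution *-algebra `C_c(G, A)`
in the universal norm `sup ‖(Π × V)(Φ)‖`, the supremum being over all covariant representations.
It is realized as the norm closure of the image of `C_c(G, A)` in its universal representation. -/
def CStarCrossedProduct : Type (max u w + 1) := (universalImage α μ).topologicalClosure

instance : NonUnitalCStarAlgebra (CStarCrossedProduct α μ) :=
  NonUnitalStarSubalgebra.nonUnitalCStarAlgebra (universalImage α μ).topologicalClosure
    (h_closed := NonUnitalStarSubalgebra.isClosed_topologicalClosure _)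

/-- The canonical map `C_c(G, A) → A ⋊_α G`. -/
def toCrossedProduct (Φ : C_c(G, A)) : CStarCrossedProduct α μ :=
  ⟨universalForm α μ Φ,
    NonUnitalStarSubalgebra.le_topologicalClosure _ ⟨Φ, rfl⟩⟩

end CrossedProduct

end

/-! The formula for `γ_h` on `C_c(G, A)` is dual to an operation on covariant representations. Fix
`h` and put `w_x = u(x,h)`, `φ = σ_h`. If `(Π, V)` is covariant, so is `(Π ∘ φ, Π(w_x) V_x)`: the
cocycle identity in `x` makes `x ↦ Π(w_x) V_x` multiplicative, while centrality of `w_x` and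
commutation of `φ` with `λ` give covariance. The integrated form of this twisted pair at `Φ` is that
of `(Π, V)` at `x ↦ w_x φ(Φ(x))` (`TwistDatum.integratedForm_mapCc`).

Hence, in the universal representation, `γ_h` merely re-indexes families of operators along `π ↦
D.twist π`. Re-indexing is a contractive *-homomorphism by inspection, so nothing has to be computed
with convolutions or the modular function, and it preserves the closure of the image of `C_c(G, A)`.

The cocycle identity in `h` gives the group law on `C_c(G, A)`, hence everywhere by density;
inverses come from `h⁻¹`. Strong continuity is checked on `C_c(G, A)`, where the universal norm is
at most the L¹ norm, and passes to the closure by contractivity. -/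

noncomputable section

/-! ### Unitary and central multipliers acting on `A`. -/

section Multipliers

variable {A : Type w} [NonUnitalCStarAlgebra A]

/-- Since `(m a)* = a* m*`, the double centralizer identity moves `m*` onto `m b`, where it cancels
`m`. -/
theorem star_fst_mul_fst_of_mem_unitary {m : 𝓜(ℂ, A)} (hm : m ∈ unitary 𝓜(ℂ, A)) (a b : A) :
    star (m.fst a) * m.fst b = star a * b := by
  have h : (star m).fst (m.fst b) = b := by
    have := congrArg (fun n : 𝓜(ℂ, A) => n.fst b) hm.1
    simpa using this
  have h' := (star m).central (star a) (m.fst b)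
  rw [h] at h'
  simpa using h'

theorem norm_fst_of_mem_unitary {m : 𝓜(ℂ, A)} (hm : m ∈ unitary 𝓜(ℂ, A)) (a : A) :
    ‖m.fst a‖ = ‖a‖ := by
  have h := congrArg norm (star_fst_mul_fst_of_mem_unitary hm a a)
  rw [CStarRing.norm_star_mul_self, CStarRing.norm_star_mul_self] at h
  exact (mul_self_inj (norm_nonneg _) (norm_nonneg _)).1 h

/-- Evaluate at `b` the commutation of `m` with the image of `a` in the multiplier algebra. -/
theorem fst_mul_of_mem_center {m : 𝓜(ℂ, A)} (hm : m ∈ Set.center 𝓜(ℂ, A)) (a b : A) :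
    m.fst (a * b) = a * m.fst b := by
  have h := congrArg (fun n : 𝓜(ℂ, A) => n.fst b) (hm.comm (a : 𝓜(ℂ, A))).eq
  simpa using h

theorem multiplierExtend_fst_apply (φ : A ≃⋆ₐ[ℂ] A) (m : 𝓜(ℂ, A)) (a : A) :
    (multiplierExtend φ m).fst (φ a) = φ (m.fst a) := by
  change φ (m.fst (φ.symm (φ a))) = _
  rw [φ.symm_apply_apply]

/-- Unitary multipliers are isometric on `A`, so left strict continuity at fixed vectors upgrades to
a moving argument. -/
theorem continuous_fst_apply_of_mem_unitary {X : Type*} [TopologicalSpace X] {m : X → 𝓜(ℂ, A)}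
    (hu : ∀ x, m x ∈ unitary 𝓜(ℂ, A)) (hm : ∀ a : A, Continuous fun x => (m x).fst a)
    {f : X → A} (hf : Continuous f) : Continuous fun x => (m x).fst (f x) := by
  rw [continuous_iff_continuousAt]
  intro x₀
  have h1 : Tendsto (fun x => (m x).fst (f x₀)) (𝓝 x₀) (𝓝 ((m x₀).fst (f x₀))) :=
    (hm (f x₀)).continuousAt
  have h2 : Tendsto (fun x => (m x).fst (f x - f x₀)) (𝓝 x₀) (𝓝 0) := by
    rw [tendsto_zero_iff_norm_tendsto_zero]
    have h3 : Tendsto (fun x => ‖f x - f x₀‖) (𝓝 x₀) (𝓝 0) := by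
      have := (hf.sub (continuous_const (y := f x₀))).norm.tendsto x₀
      simpa using this
    exact h3.congr fun x => (norm_fst_of_mem_unitary (hu x) _).symm
  have := h1.add h2
  rw [add_zero] at this
  refine this.congr fun x => ?_
  rw [← map_add, add_sub_cancel]

end Multipliers

/-- A family of contractions that is strongly continuous on a dense span is strongly continuous. -/
theorem continuous_clm_apply_of_dense {X E : Type*} [TopologicalSpace X] [NormedAddCommGroup E]
    [NormedSpace ℂ E] {W : X → E →L[ℂ] E} (hW : ∀ x ξ, ‖W x ξ‖ ≤ ‖ξ‖) {S : Set E}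
    (hS : (Submodule.span ℂ S).topologicalClosure = ⊤)
    (hc : ∀ ξ ∈ S, Continuous fun x => W x ξ) (ξ : E) : Continuous fun x => W x ξ := by
  have hspan : ∀ ξ ∈ Submodule.span ℂ S, Continuous fun x => W x ξ := by
    intro ξ hξ
    induction hξ using Submodule.span_induction with
    | mem ξ h => exact hc ξ h
    | zero => simpa using continuous_const
    | add ξ η _ _ h1 h2 =>
      simp only [map_add]
      exact h1.add h2
    | smul c ξ _ h =>
      simp only [map_smul]
      exact h.const_smul c
  have hξ : ξ ∈ closure (Submodule.span ℂ S : Set E) := by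
    rw [← Submodule.topologicalClosure_coe, hS]; trivial
  -- Contractivity makes the approximation by `W x η` uniform in `x`.
  refine continuous_of_uniform_approx_of_continuous fun s hs => ?_
  obtain ⟨ε, hε, hs⟩ := Metric.mem_uniformity_dist.1 hs
  obtain ⟨η, hη, hd⟩ := Metric.mem_closure_iff.1 hξ ε hε
  refine ⟨fun x => W x η, hspan η hη, fun x => hs ?_⟩
  rw [dist_eq_norm, ← map_sub]
  exact (hW x _).trans_lt (by rwa [← dist_eq_norm])

/-! ### Extending a nondegenerate representation to unitary multipliers. -/

namespace CovariantRep

variable {G : Type u} {A : Type w} [Group G] [TopologicalSpace G] [NonUnitalCStarAlgebra A]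
variable {α : CStarAction G A} (π : CovariantRep α)

/-- Bounded operators that agree on the vectors `Π(a) ξ` are equal. -/
theorem ext_rep {S T : π.space →L[ℂ] π.space} (h : ∀ a ξ, S (π.rep a ξ) = T (π.rep a ξ)) :
    S = T := by
  refine ContinuousLinearMap.ext_on ?_ (s := {η : π.space | ∃ a ξ, π.rep a ξ = η}) ?_
  · rw [dense_iff_closure_eq, ← Submodule.topologicalClosure_coe, π.nondegenerate]; rfl
  · rintro _ ⟨a, ξ, rfl⟩
    exact h a ξ

/-- The linear map `a ⊗ ξ ↦ Π(φ a) ξ`. -/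
def tensorMap (φ : A →ₗ[ℂ] A) : TensorProduct ℂ A π.space →ₗ[ℂ] π.space :=
  TensorProduct.lift
    (LinearMap.mk₂ ℂ (fun a ξ => π.rep (φ a) ξ) (fun a b ξ => by simp) (fun c a ξ => by simp)
      (fun a ξ η => by simp) (fun c a ξ => by simp))

@[simp]
theorem tensorMap_tmul (φ : A →ₗ[ℂ] A) (a : A) (ξ : π.space) :
    π.tensorMap φ (a ⊗ₜ ξ) = π.rep (φ a) ξ := rfl

/-- This is nondegeneracy. On the algebraic tensor product, `a ⊗ ξ ↦ Π(m a) ξ` raises no question of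
well-definedness; the norm identity below lets it descend to this dense range and extend. -/
theorem denseRange_tensorMap : DenseRange (π.tensorMap LinearMap.id) := by
  have h : (Submodule.span ℂ {η : π.space | ∃ a ξ, π.rep a ξ = η})
      ≤ LinearMap.range (π.tensorMap LinearMap.id) := by
    rw [Submodule.span_le]
    rintro _ ⟨a, ξ, rfl⟩
    exact ⟨a ⊗ₜ ξ, rfl⟩
  have hd : Dense (Submodule.span ℂ {η : π.space | ∃ a ξ, π.rep a ξ = η} : Set π.space) := by
    rw [dense_iff_closure_eq, ← Submodule.topologicalClosure_coe, π.nondegenerate]; rfl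
  exact hd.mono h

theorem inner_rep_rep (a b : A) (ξ η : π.space) :
    inner ℂ (π.rep a ξ) (π.rep b η) = inner ℂ ξ (π.rep (star a * b) η) := by
  rw [map_mul, _root_.mul_apply_eq_comp, map_star, ContinuousLinearMap.star_eq_adjoint,
    ContinuousLinearMap.adjoint_inner_right]

/-- On elementary tensors, `⟨Π(ma)ξ, Π(mb)η⟩ = ⟨ξ, Π((ma)*(mb))η⟩ = ⟨ξ, Π(a*b)η⟩`; sums follow by
sesquilinearity. -/
theorem norm_tensorMap_fst {m : 𝓜(ℂ, A)} (hm : m ∈ unitary 𝓜(ℂ, A))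
    (t : TensorProduct ℂ A π.space) :
    ‖π.tensorMap m.fst t‖ = ‖π.tensorMap LinearMap.id t‖ := by
  have h : ∀ s t, inner ℂ (π.tensorMap m.fst s) (π.tensorMap m.fst t)
      = inner ℂ (π.tensorMap LinearMap.id s) (π.tensorMap LinearMap.id t) := by
    intro s t
    induction s with
    | zero => simp
    | add s s' h h' => simp only [map_add, inner_add_left, h, h']
    | tmul a ξ =>
      induction t with
      | zero => simp
      | add t t' h h' => simp only [map_add, inner_add_right, h, h']
      | tmul b η =>
        simp [inner_rep_rep, star_fst_mul_fst_of_mem_unitary hm]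
  rw [norm_eq_sqrt_re_inner (𝕜 := ℂ), norm_eq_sqrt_re_inner (𝕜 := ℂ), h]

/-- The value at the unitary multiplier `m` of the extension of the representation `Π` to the
multiplier algebra: the operator with `Π(a) ξ ↦ Π(m a) ξ`. -/
def multiplierOp (m : 𝓜(ℂ, A)) : π.space →L[ℂ] π.space :=
  (π.tensorMap m.fst).extendOfNorm (π.tensorMap LinearMap.id)

theorem multiplierOp_rep {m : 𝓜(ℂ, A)} (hm : m ∈ unitary 𝓜(ℂ, A)) (a : A) (ξ : π.space) :
    π.multiplierOp m (π.rep a ξ) = π.rep (m.fst a) ξ :=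
  LinearMap.extendOfNorm_eq π.denseRange_tensorMap
    ⟨1, fun t => by rw [one_mul, π.norm_tensorMap_fst hm]⟩ (a ⊗ₜ[ℂ] ξ)

theorem norm_multiplierOp {m : 𝓜(ℂ, A)} (hm : m ∈ unitary 𝓜(ℂ, A)) (ξ : π.space) :
    ‖π.multiplierOp m ξ‖ = ‖ξ‖ := by
  have h : (fun ξ => ‖π.multiplierOp m ξ‖) = fun ξ => ‖ξ‖ := by
    refine π.denseRange_tensorMap.equalizer (by fun_prop) (by fun_prop) (funext fun t => ?_)
    have := LinearMap.extendOfNorm_eq (f := π.tensorMap m.fst) π.denseRange_tensorMap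
      ⟨1, fun t => by rw [one_mul, π.norm_tensorMap_fst hm]⟩ t
    simp only [Function.comp_apply, multiplierOp, this, π.norm_tensorMap_fst hm]
  exact congrFun h ξ

/-- On a vector `Π(b) ξ` this is `m(ab) = a(mb)`. Centrality is what lets `Π(w_x)` slide past `Π`,
both in covariance and in the integrated form. -/
theorem multiplierOp_rep_comm {m : 𝓜(ℂ, A)} (hm : m ∈ unitary 𝓜(ℂ, A))
    (hc : m ∈ Set.center 𝓜(ℂ, A)) (a : A) (ξ : π.space) :
    π.multiplierOp m (π.rep a ξ) = π.rep a (π.multiplierOp m ξ) := by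
  have : π.multiplierOp m * π.rep a = π.rep a * π.multiplierOp m := by
    refine π.ext_rep fun b ξ => ?_
    have h : π.rep a (π.rep b ξ) = π.rep (a * b) ξ := by
      rw [map_mul, _root_.mul_apply_eq_comp]
    rw [_root_.mul_apply_eq_comp, _root_.mul_apply_eq_comp, h, π.multiplierOp_rep hm,
      π.multiplierOp_rep hm, fst_mul_of_mem_center hc, map_mul, _root_.mul_apply_eq_comp]
  exact congrArg (fun T : π.space →L[ℂ] π.space => T ξ) this

end CovariantRep

/-! ### Twisting covariant representations by a central cocycle and an automorphism. -/

/-- A central unitary cocycle `w` for the action `α`, together with an automorphism `φ` commuting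
with `α`: the data that twist a covariant representation. -/
structure TwistDatum {G : Type u} {A : Type w} [Group G] [TopologicalSpace G]
    [NonUnitalCStarAlgebra A] (α : CStarAction G A) where
  aut : A ≃⋆ₐ[ℂ] A
  aut_comm : ∀ x a, α x (aut a) = aut (α x a)
  cocycle : G → 𝓜(ℂ, A)
  cocycle_unitary : ∀ x, cocycle x ∈ unitary 𝓜(ℂ, A)
  cocycle_central : ∀ x, cocycle x ∈ Set.center 𝓜(ℂ, A)
  cocycle_continuous : ∀ a : A, Continuous fun x => (cocycle x).fst a
  cocycle_mul : ∀ x y, cocycle (x * y) = cocycle x * multiplierExtend (α x) (cocycle y)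

namespace TwistDatum

variable {G : Type u} {A : Type w} [Group G] [TopologicalSpace G] [NonUnitalCStarAlgebra A]
variable {α : CStarAction G A} (D : TwistDatum α) (π : CovariantRep α)

/-- The operator `Π(w_x) V_x`. -/
def unitOp (x : G) : π.space →L[ℂ] π.space :=
  π.multiplierOp (D.cocycle x) * (π.unit x : π.space →L[ℂ] π.space)

theorem unitOp_apply (x : G) (ξ : π.space) : D.unitOp π x ξ
    = π.multiplierOp (D.cocycle x) ((π.unit x : π.space →L[ℂ] π.space) ξ) := rfl

theorem unitOp_rep (x : G) (a : A) (ξ : π.space) : D.unitOp π x (π.rep a ξ)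
    = π.rep ((D.cocycle x).fst (α x a)) ((π.unit x : π.space →L[ℂ] π.space) ξ) := by
  rw [unitOp_apply, π.unit_rep_apply, π.multiplierOp_rep (D.cocycle_unitary x)]

theorem norm_unitOp (x : G) (ξ : π.space) : ‖D.unitOp π x ξ‖ = ‖ξ‖ := by
  rw [unitOp_apply, π.norm_multiplierOp (D.cocycle_unitary x), π.norm_unit]

/-- On `Π(a) ξ` it reduces to `w_{xy} α_{xy}(a) = w_x α_x(w_y α_y(a))`, which is the cocycle
identity. -/
theorem unitOp_mul (x y : G) : D.unitOp π (x * y) = D.unitOp π x * D.unitOp π y := by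
  refine π.ext_rep fun a ξ => ?_
  rw [_root_.mul_apply_eq_comp, unitOp_rep, unitOp_rep, unitOp_rep, π.unit_mul_apply,
    D.cocycle_mul, DoubleCentralizer.mul_fst, _root_.mul_apply_eq_comp, map_mul,
    ← multiplierExtend_fst_apply]
  rfl

/-- At `x = y = 1` the cocycle identity reads `w_1 = w_1²`, and a unitary idempotent is `1`. -/
theorem cocycle_one : D.cocycle 1 = 1 := by
  have h := D.cocycle_mul 1 1
  have h1 : multiplierExtend (α 1) (D.cocycle 1) = D.cocycle 1 := by
    rw [map_one]; rfl
  rw [one_mul, h1] at h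
  have h2 : star (D.cocycle 1) * D.cocycle 1 = 1 := (D.cocycle_unitary 1).1
  calc D.cocycle 1 = star (D.cocycle 1) * D.cocycle 1 * D.cocycle 1 := by rw [h2, one_mul]
    _ = 1 := by rw [mul_assoc, ← h, h2]

theorem unitOp_one : D.unitOp π 1 = 1 := by
  refine π.ext_rep fun a ξ => ?_
  rw [unitOp_rep, cocycle_one]
  simp

theorem star_unitOp_mul_self (x : G) : star (D.unitOp π x) * D.unitOp π x = 1 :=
  (ContinuousLinearMap.norm_map_iff_adjoint_comp_self _).1 (D.norm_unitOp π x)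

/-- An isometry with a right inverse is unitary; the right inverse is the operator at `x⁻¹`. -/
theorem unitOp_mem_unitary (x : G) : D.unitOp π x ∈ unitary (π.space →L[ℂ] π.space) := by
  refine ⟨D.star_unitOp_mul_self π x, ?_⟩
  have h : D.unitOp π x * D.unitOp π x⁻¹ = 1 := by
    rw [← unitOp_mul, mul_inv_cancel, unitOp_one]
  rwa [left_inv_eq_right_inv (D.star_unitOp_mul_self π x) h]

/-- On `Π(a) ξ` the orbit is `Π(w_x α_x(a)) V_x ξ`, continuous by strict continuity of `w`; such
vectors span a dense subspace. -/
theorem continuous_unitOp (ξ : π.space) : Continuous fun x => D.unitOp π x ξ := by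
  refine continuous_clm_apply_of_dense (fun x ξ => (D.norm_unitOp π x ξ).le) π.nondegenerate ?_ ξ
  rintro _ ⟨a, ξ, rfl⟩
  simp only [unitOp_rep]
  exact π.continuous_rep_unit (continuous_fst_apply_of_mem_unitary D.cocycle_unitary
    D.cocycle_continuous (α.continuous_orbit a)) continuous_id ξ

theorem unitOp_rep_aut (x : G) (a : A) (ξ : π.space) :
    D.unitOp π x (π.rep (D.aut a) ξ) = π.rep (D.aut (α x a)) (D.unitOp π x ξ) := by
  rw [unitOp_apply, unitOp_apply, π.unit_rep_apply, D.aut_comm,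
    π.multiplierOp_rep_comm (D.cocycle_unitary x) (D.cocycle_central x)]

/-- The covariant representation `(Π ∘ φ, x ↦ Π(w_x) V_x)`. -/
def twist : CovariantRep α where
  space := π.space
  rep := π.rep.comp (D.aut : A →⋆ₙₐ[ℂ] A)
  unit :=
    { toFun := fun x => ⟨D.unitOp π x, D.unitOp_mem_unitary π x⟩
      map_one' := Subtype.ext (D.unitOp_one π)
      map_mul' := fun x y => Subtype.ext (D.unitOp_mul π x y) }
  nondegenerate := by
    -- As `φ` is surjective, `Π ∘ φ` and `Π` have the same set of vectors `Π(a) ξ`.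
    rw [← π.nondegenerate]
    congr 3
    ext η
    constructor
    · rintro ⟨a, ξ, rfl⟩
      exact ⟨D.aut a, ξ, rfl⟩
    · rintro ⟨a, ξ, rfl⟩
      refine ⟨D.aut.symm a, ξ, ?_⟩
      change π.rep (D.aut (D.aut.symm a)) ξ = _
      rw [D.aut.apply_symm_apply]
  continuous_unit := D.continuous_unitOp π
  covariant x a := by
    change D.unitOp π x * π.rep (D.aut a) * star (D.unitOp π x) = π.rep (D.aut (α x a))
    have h : D.unitOp π x * π.rep (D.aut a) = π.rep (D.aut (α x a)) * D.unitOp π x :=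
      ContinuousLinearMap.ext fun ξ => D.unitOp_rep_aut π x a ξ
    rw [h, mul_assoc, (D.unitOp_mem_unitary π x).2, mul_one]

/-- The map `Φ ↦ (x ↦ w_x φ(Φ(x)))` of `C_c(G, A)`. -/
def mapCc (Φ : C_c(G, A)) : C_c(G, A) where
  toFun x := (D.cocycle x).fst (D.aut (Φ x))
  continuous_toFun := continuous_fst_apply_of_mem_unitary D.cocycle_unitary D.cocycle_continuous
    ((StarAlgEquiv.isometry D.aut).continuous.comp Φ.continuous)
  hasCompactSupport' := Φ.hasCompactSupport.mono fun x hx h => hx (by simp [h])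

theorem mapCc_apply (Φ : C_c(G, A)) (x : G) : D.mapCc Φ x = (D.cocycle x).fst (D.aut (Φ x)) := rfl

variable [MeasurableSpace G] [BorelSpace G] (μ : Measure G)

/-- The duality behind the whole argument. The integrands agree pointwise: `Π(w_x φ(Φ(x))) V_x =
Π(φ(Φ(x))) Π(w_x) V_x`, by centrality. -/
theorem integratedForm_mapCc [IsFiniteMeasureOnCompacts μ] (Φ : C_c(G, A)) :
    π.integratedForm μ (D.mapCc Φ) = (D.twist π).integratedForm μ Φ := by
  refine ContinuousLinearMap.ext fun ξ => ?_
  change ∫ x, π.rep ((D.cocycle x).fst (D.aut (Φ x))) ((π.unit x : π.space →L[ℂ] π.space) ξ) ∂μ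
    = ∫ x, π.rep (D.aut (Φ x)) (D.unitOp π x ξ) ∂μ
  congr with x
  rw [unitOp_apply, ← π.multiplierOp_rep_comm (D.cocycle_unitary x) (D.cocycle_central x),
    π.multiplierOp_rep (D.cocycle_unitary x)]

end TwistDatum

end

/-! ### The induced maps and action on the crossed product. -/

noncomputable section

variable {G : Type u} {A : Type w} [Group G] [TopologicalSpace G] [NonUnitalCStarAlgebra A]
variable {α : CStarAction G A}

/-- Twisting the index of a bounded family of operators. -/
def TwistDatum.reindex (D : TwistDatum α) : OperatorFamilies α →⋆ₙₐ[ℂ] OperatorFamilies α where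
  toFun T := (⟨fun π =>
      (show lp (fun π : CovariantRep α => π.space →L[ℂ] π.space) ∞ from T).1 (D.twist π),
    memℓp_infty ⟨‖T‖, by
      rintro _ ⟨π, rfl⟩
      exact lp.norm_apply_le_norm ENNReal.top_ne_zero _ _⟩⟩ :
      lp (fun π : CovariantRep α => π.space →L[ℂ] π.space) ∞)
  -- All operations on families are coordinatewise, so they commute with re-indexing by definition.
  map_smul' _ _ := rfl
  map_zero' := rfl
  map_add' _ _ := rfl
  map_mul' _ _ := rfl
  map_star' _ := rfl

variable [IsTopologicalGroup G] [LocallyCompactSpace G] [MeasurableSpace G] [BorelSpace G]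
  (μ : Measure G) [μ.IsHaarMeasure]

/-- Identifies re-indexing on the image of `C_c(G, A)` with the concrete formula, which thereby
respects products, adjoints and the universal norm bound. -/
theorem TwistDatum.reindex_universalForm (D : TwistDatum α) (Φ : C_c(G, A)) :
    D.reindex (universalForm α μ Φ) = universalForm α μ (D.mapCc Φ) :=
  lp.ext (funext fun π => (D.integratedForm_mapCc π μ Φ).symm)

theorem TwistDatum.reindex_mem (D : TwistDatum α) {T : OperatorFamilies α}
    (hT : T ∈ (universalImage α μ).topologicalClosure) :
    D.reindex T ∈ (universalImage α μ).topologicalClosure := by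
  have hc : Continuous D.reindex :=
    AddMonoidHomClass.continuous_of_bound D.reindex 1 fun a => by
      simpa only [one_mul] using NonUnitalStarAlgHom.norm_apply_le D.reindex a
  refine map_mem_closure hc hT ?_
  rintro _ ⟨Φ, rfl⟩
  exact ⟨D.mapCc Φ, (D.reindex_universalForm μ Φ).symm⟩

/-- The endomorphism of the crossed product induced by a twist. -/
def TwistDatum.crossedMap (D : TwistDatum α) :
    CStarCrossedProduct α μ →⋆ₙₐ[ℂ] CStarCrossedProduct α μ where
  toFun b := (⟨D.reindex b.1, D.reindex_mem μ b.2⟩ : (universalImage α μ).topologicalClosure)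
  map_smul' c b := Subtype.ext (map_smul D.reindex c b.1)
  map_zero' := Subtype.ext (map_zero D.reindex)
  map_add' b c := Subtype.ext (map_add D.reindex b.1 c.1)
  map_mul' b c := Subtype.ext (map_mul D.reindex b.1 c.1)
  map_star' b := Subtype.ext (map_star D.reindex b.1)

theorem TwistDatum.crossedMap_toCrossedProduct (D : TwistDatum α) (Φ : C_c(G, A)) :
    D.crossedMap μ (toCrossedProduct α μ Φ) = toCrossedProduct α μ (D.mapCc Φ) :=
  Subtype.ext (D.reindex_universalForm μ Φ)

theorem denseRange_toCrossedProduct : DenseRange (toCrossedProduct α μ) := by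
  intro b
  refine (closure_subtype (p := fun T => T ∈ (universalImage α μ).topologicalClosure)
    (x := b)).2 ?_
  have hb : b.1 ∈ closure (Set.range (universalForm α μ)) := b.2
  refine closure_mono ?_ hb
  rintro _ ⟨Φ, rfl⟩
  exact ⟨toCrossedProduct α μ Φ, ⟨Φ, rfl⟩, rfl⟩

/-- Every integrated form is bounded by the L¹ norm, hence so is their supremum. -/
theorem norm_toCrossedProduct_le (Φ : C_c(G, A)) :
    ‖toCrossedProduct α μ Φ‖ ≤ ∫ x, ‖Φ x‖ ∂μ :=
  lp.norm_le_of_forall_le (integral_nonneg fun _ => norm_nonneg _)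
    fun π => π.norm_integratedForm_le μ Φ

theorem toCrossedProduct_sub (Φ Ψ : C_c(G, A)) :
    toCrossedProduct α μ Φ - toCrossedProduct α μ Ψ = toCrossedProduct α μ (Φ - Ψ) :=
  Subtype.ext (map_sub (universalForm α μ) Φ Ψ).symm

theorem continuous_crossedMap (D : TwistDatum α) : Continuous (D.crossedMap μ) :=
  AddMonoidHomClass.continuous_of_bound (D.crossedMap μ) 1 fun a => by
    simpa only [one_mul] using NonUnitalStarAlgHom.norm_apply_le (D.crossedMap μ) a

/-- An action on the crossed product is determined by its restriction to `C_c(G, A)`. -/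
theorem CStarAction.ext_crossedProduct {H : Type v} [Group H] [TopologicalSpace H]
    {γ δ : CStarAction H (CStarCrossedProduct α μ)}
    (h : ∀ (k : H) (Φ : C_c(G, A)), γ k (toCrossedProduct α μ Φ) = δ k (toCrossedProduct α μ Φ)) :
    γ = δ := by
  have : γ.toHom = δ.toHom := by
    ext k b
    exact congrFun ((denseRange_toCrossedProduct μ).equalizer
      (StarAlgEquiv.isometry (γ k)).continuous (StarAlgEquiv.isometry (δ k)).continuous
      (funext (h k))) b
  cases γ; cases δ; cases this; rfl


theorem TwistDatum.crossedMap_one {D : TwistDatum α} (hone : ∀ Φ, D.mapCc Φ = Φ)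
    (b : CStarCrossedProduct α μ) : D.crossedMap μ b = b := by
  refine congrFun ((denseRange_toCrossedProduct μ).equalizer (continuous_crossedMap μ _)
    continuous_id (funext fun Φ => ?_)) b
  simp [TwistDatum.crossedMap_toCrossedProduct, hone]

theorem TwistDatum.crossedMap_mul {D E F : TwistDatum α}
    (hmul : ∀ Φ, F.mapCc Φ = D.mapCc (E.mapCc Φ)) (b : CStarCrossedProduct α μ) :
    F.crossedMap μ b = D.crossedMap μ (E.crossedMap μ b) := by
  refine congrFun ((denseRange_toCrossedProduct μ).equalizer (continuous_crossedMap μ _)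
    ((continuous_crossedMap μ _).comp (continuous_crossedMap μ _)) (funext fun Φ => ?_)) b
  simp [TwistDatum.crossedMap_toCrossedProduct, hmul]

/-- For `Φ` in `C_c(G, A)` the orbit is continuous already in the L¹ norm; density and contractivity
do the rest. -/
theorem continuous_crossedMap_orbit {H : Type v} [TopologicalSpace H] {D : H → TwistDatum α}
    (hD : ∀ Φ : C_c(G, A), Continuous fun p : H × G => (D p.1).mapCc Φ p.2)
    (b : CStarCrossedProduct α μ) : Continuous fun h => (D h).crossedMap μ b := by
  have hCc : ∀ Φ : C_c(G, A), Continuous fun h => (D h).crossedMap μ (toCrossedProduct α μ Φ) := by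
    intro Φ
    rw [continuous_iff_continuousAt]
    intro h₀
    have hint : Continuous fun h => ∫ x, ‖(D h).mapCc Φ x - (D h₀).mapCc Φ x‖ ∂μ := by
      rw [← continuousOn_univ]
      -- Each twisted function vanishes wherever `Φ` does, so one compact set serves all `h`.
      refine continuousOn_integral_of_compact_support Φ.hasCompactSupport ?_ ?_
      · refine Continuous.continuousOn ?_
        exact ((hD Φ).sub (((D h₀).mapCc Φ).continuous.comp continuous_snd)).norm
      · intro h x _ hx
        simp [TwistDatum.mapCc_apply, image_eq_zero_of_notMem_tsupport hx]
    have hlim := hint.tendsto h₀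
    simp only [sub_self, norm_zero, integral_zero] at hlim
    refine tendsto_iff_norm_sub_tendsto_zero.2 (squeeze_zero (fun _ => norm_nonneg _)
      (fun h => ?_) hlim)
    simp only [TwistDatum.crossedMap_toCrossedProduct,
      toCrossedProduct_sub]
    exact norm_toCrossedProduct_le μ _
  refine continuous_of_uniform_approx_of_continuous fun s hs => ?_
  obtain ⟨ε, hε, hs⟩ := Metric.mem_uniformity_dist.1 hs
  obtain ⟨Φ, hd⟩ := (denseRange_toCrossedProduct (α := α) μ).exists_dist_lt b hε
  refine ⟨fun h => (D h).crossedMap μ (toCrossedProduct α μ Φ), hCc Φ, fun h => hs ?_⟩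
  rw [dist_eq_norm, ← map_sub]
  exact (NonUnitalStarAlgHom.norm_apply_le ((D h).crossedMap μ) _).trans_lt
    (by rwa [← dist_eq_norm])

/-- The action on the crossed product given by a strongly continuous family of twists. -/
def crossedAction {H : Type v} [Group H] [TopologicalSpace H] (D : H → TwistDatum α)
    (hone : ∀ Φ, (D 1).mapCc Φ = Φ)
    (hmul : ∀ h g Φ, (D (h * g)).mapCc Φ = (D h).mapCc ((D g).mapCc Φ))
    (hD : ∀ Φ : C_c(G, A), Continuous fun p : H × G => (D p.1).mapCc Φ p.2) :
    CStarAction H (CStarCrossedProduct α μ) where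
  toHom :=
    { toFun := fun h =>
        { (D h).crossedMap μ with
          invFun := (D h⁻¹).crossedMap μ
          left_inv := fun b => by
            change (D h⁻¹).crossedMap μ ((D h).crossedMap μ b) = b
            rw [← TwistDatum.crossedMap_mul μ (hmul h⁻¹ h), inv_mul_cancel,
              TwistDatum.crossedMap_one μ hone]
          right_inv := fun b => by
            change (D h).crossedMap μ ((D h⁻¹).crossedMap μ b) = b
            rw [← TwistDatum.crossedMap_mul μ (hmul h h⁻¹), mul_inv_cancel,
              TwistDatum.crossedMap_one μ hone] }
      map_one' := StarAlgEquiv.ext fun b => TwistDatum.crossedMap_one μ hone b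
      map_mul' := fun h g => StarAlgEquiv.ext fun b => TwistDatum.crossedMap_mul μ (hmul h g) b }
  continuous_orbit := continuous_crossedMap_orbit μ hD

theorem crossedAction_toCrossedProduct {H : Type v} [Group H] [TopologicalSpace H]
    {D : H → TwistDatum α} {hone : ∀ Φ, (D 1).mapCc Φ = Φ}
    {hmul : ∀ h g Φ, (D (h * g)).mapCc Φ = (D h).mapCc ((D g).mapCc Φ)}
    {hD : ∀ Φ : C_c(G, A), Continuous fun p : H × G => (D p.1).mapCc Φ p.2} (h : H)
    (Φ : C_c(G, A)) : crossedAction μ D hone hmul hD h (toCrossedProduct α μ Φ)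
      = toCrossedProduct α μ ((D h).mapCc Φ) :=
  (D h).crossedMap_toCrossedProduct μ Φ

end

/-! ### Assembling the action from the two-variable cocycle. -/

theorem mainTheorem9 {G : Type u} {H : Type v} {A : Type w}
    [Group G] [TopologicalSpace G] [IsTopologicalGroup G] [LocallyCompactSpace G]
    [MeasurableSpace G] [BorelSpace G] (μ : Measure G) [μ.IsHaarMeasure]
    [Group H] [TopologicalSpace H] [IsTopologicalGroup H] [LocallyCompactSpace H]
    [NonUnitalCStarAlgebra A]
    (lam : CStarAction G A) (sig : CStarAction H A)
    (commute : ∀ (x : G) (h : H) (a : A), lam x (sig h a) = sig h (lam x a))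
    (u : G → H → 𝓜(ℂ, A))
    (u_unitary : ∀ x h, u x h ∈ unitary 𝓜(ℂ, A))
    (u_central : ∀ x h, u x h ∈ Set.center 𝓜(ℂ, A))
    (u_continuous : StrictlyContinuous fun p : G × H => u p.1 p.2)
    (u_cocycle_left : ∀ (x y : G) (h : H),
      u (x * y) h = u x h * multiplierExtend (lam x) (u y h))
    (u_cocycle_right : ∀ (x : G) (h g : H),
      u x (h * g) = u x h * multiplierExtend (sig h) (u x g)) :
    ∃! γ : CStarAction H (CStarCrossedProduct lam μ),
      ∀ (h : H) (Φ : C_c(G, A)), ∃ Ψ : C_c(G, A),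
        (∀ x : G, Ψ x = (u x h).fst (sig h (Φ x))) ∧
        γ h (toCrossedProduct lam μ Φ) = toCrossedProduct lam μ Ψ := by
  let D : H → TwistDatum lam := fun h =>
    { aut := sig h
      aut_comm := fun x a => commute x h a
      cocycle := fun x => u x h
      cocycle_unitary := fun x => u_unitary x h
      cocycle_central := fun x => u_central x h
      cocycle_continuous := fun a => (u_continuous.1 a).comp (Continuous.prodMk_left h)
      cocycle_mul := fun x y => u_cocycle_left x y h }
  have hmul : ∀ h g Φ, (D (h * g)).mapCc Φ = (D h).mapCc ((D g).mapCc Φ) := by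
    intro h g Φ
    ext x
    change (u x (h * g)).fst (sig (h * g) (Φ x))
      = (u x h).fst (sig h ((u x g).fst (sig g (Φ x))))
    -- Both sides become `u(x,h) σ_h(u(x,g) σ_g(Φ(x)))`.
    rw [u_cocycle_right, DoubleCentralizer.mul_fst, _root_.mul_apply_eq_comp, map_mul,
      ← multiplierExtend_fst_apply]
    rfl
  have hone : ∀ Φ, (D 1).mapCc Φ = Φ := by
    intro Φ
    ext x
    -- Again a unitary idempotent, now from the cocycle identity in `h`.
    have h1 : u x 1 = 1 := by
      have h := u_cocycle_right x 1 1
      have h' : multiplierExtend (sig 1) (u x 1) = u x 1 := by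
        rw [map_one]; rfl
      rw [one_mul, h'] at h
      have h2 : star (u x 1) * u x 1 = 1 := (u_unitary x 1).1
      calc u x 1 = star (u x 1) * u x 1 * u x 1 := by rw [h2, one_mul]
        _ = 1 := by rw [mul_assoc, ← h, h2]
    change (u x 1).fst (sig 1 (Φ x)) = Φ x
    rw [h1, map_one]
    rfl
  have hD : ∀ Φ : C_c(G, A), Continuous fun p : H × G => (D p.1).mapCc Φ p.2 := by
    intro Φ
    exact continuous_fst_apply_of_mem_unitary (m := fun p : H × G => u p.2 p.1)
      (fun p => u_unitary p.2 p.1) (fun a => (u_continuous.1 a).comp continuous_swap)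
      (sig.continuous_apply continuous_fst (Φ.continuous.comp continuous_snd))
  refine ⟨crossedAction μ D hone hmul hD, fun h Φ =>
    ⟨(D h).mapCc Φ, fun x => rfl, crossedAction_toCrossedProduct μ h Φ⟩, fun γ hγ => ?_⟩
  refine CStarAction.ext_crossedProduct μ fun h Φ => ?_
  -- The pointwise formula determines `Ψ`, so any competing `γ` agrees on the dense image of `C_c(G,
  -- A)`.
  obtain ⟨Ψ, hΨ, hγΨ⟩ := hγ h Φ
  rw [hγΨ, crossedAction_toCrossedProduct]
  congr 1
  ext x
  exact hΨ x
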